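/- There is an absolute constant $c>0$ such that for every integer $t>1$ there is an integer $n_0=n_0(t)$ with the following property. Let $n\ge n_0$, and let $G$ be a graph that contains an $n$-vertex path $P$ and does not contain $K_t$ as a topological minor (that is, no subgraph of $G$ is a subdivision of $K_t$). Then the subgraph $G[P]$ of $G$ induced by the vertices of $P$ contains an induced path of order (number of vertices) at least $$(\log n)^{\frac{c}{t(\log t)^2}}$$ that is increasing along $P$, i.e. the vertices of the induced path, taken in their order on that path, occur in this same order on $P$. Logarithms are in base $2$. -/

import Mathlib

/-- A subdivision of `H` inside `G`: the vertices of `H` are mapped injectively to vertices of `G`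
(the branch vertices), every edge `uv` of `H` is replaced by a path of `G` joining the two
corresponding branch vertices (the same path, up to reversal, for `uv` and `vu`), no path contains
a branch vertex other than its two ends, and the paths of two distinct edges meet at most in
branch vertices. -/
structure SubdivisionIn {W V : Type*} (H : SimpleGraph W) (G : SimpleGraph V) where
  /-- The branch vertices. -/
  branch : W ↪ V
  /-- The path that replaces an edge of `H`. -/
  walk : ∀ {u v : W}, H.Adj u v → G.Walk (branch u) (branch v)
  isPath : ∀ {u v : W} (h : H.Adj u v), (walk h).IsPath
  walk_symm : ∀ {u v : W} (h : H.Adj u v), walk h.symm = (walk h).reverse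
  eq_or_eq_of_branch_mem : ∀ {u v : W} (h : H.Adj u v) (w : W),
    branch w ∈ (walk h).support → w = u ∨ w = v
  mem_range_of_mem_of_mem : ∀ {u v u' v' : W} (h : H.Adj u v) (h' : H.Adj u' v') (x : V),
    s(u, v) ≠ s(u', v') → x ∈ (walk h).support → x ∈ (walk h').support → x ∈ Set.range branch

/-- `H` is a topological minor of `G` if `G` contains some subdivision of `H` as a subgraph. -/
def IsTopologicalMinor {W V : Type*} (H : SimpleGraph W) (G : SimpleGraph V) : Prop :=
  Nonempty (SubdivisionIn H G)

/-- The subgraph `G[P]` of `G` induced by the vertices of the walk `P`. -/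
abbrev inducedOn {V : Type*} {G : SimpleGraph V} {a b : V} (P : G.Walk a b) :
    SimpleGraph {v : V // v ∈ P.support} :=
  G.induce {v : V | v ∈ P.support}

/-- An induced path of order `k` in `G[P]`, given as an embedding of the path graph on `k`
vertices as an induced subgraph, is increasing along `P` if its vertices, in their order on the
induced path, occur in this order on `P`. -/
def IsIncreasingAlong {V : Type*} {G : SimpleGraph V} {a b : V} (P : G.Walk a b) {k : ℕ}
    (Q : SimpleGraph.pathGraph k ↪g inducedOn P) : Prop :=
  ∃ pos : Fin k → ℕ, StrictMono pos ∧
    ∀ i : Fin k, pos i ≤ P.length ∧ P.getVert (pos i) = (Q i : V)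

/-!
Number the vertices of `P` by `0, …, L` along `P` and call a walk increasing if these numbers
increase. A shortest increasing walk between two vertices is induced, since a chord would be a
shortcut. Hence, if there is no increasing induced path on `k` vertices, then for every root `r` the
breadth-first tree of increasing walks from `r` reaches all vertices `r, …, L` and has depth less
than `k` (`exists_shallow_tree`).

Let `X` be a set of `2 ^ (a * k)` vertices to the right of `r`. Some vertex `u` of this tree has at
least `2 ^ a` children with descendants in `X`, which gives a subdivided star with centre `u`, with
`2 ^ a` leaves in `X`, and with legs of at most `k` vertices, all of them to the right of `u`
(`exists_spider`). The next star is built in the same way from the root `u + 1`, with leaves among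
those of the first, so its centre is a new vertex. After `t` rounds there are `t` distinct centres
and a set `Y` of common leaves (`exists_spiders`), with `|Y| ≥ 2 ^ k` if `log n ≥ k ^ (t + 1)`.

For each pair of centres, a common leaf joins the two through its legs. A vertex other than the
centre lies on at most one leg of a star, so each leaf conflicts with a number of other leaves that
is only linear in `k`, and the leaves for different pairs can be chosen greedily with legs that are
disjoint and avoid the other centres (`exists_disjoint_leaves`). The result is a subdivision of
`K_t`. So without such a subdivision `log n < k ^ (t + 1)` for large `k`, which is stronger than the
bound required (`two_pow_le_of_rpow`).
-/

open SimpleGraph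

/-! ### Increasing induced paths and breadth-first trees -/

/-- The graph `H` has an induced path on `k` vertices, all at most `L`, whose vertices increase
along the path. -/
def HasIncreasingInducedPath (H : SimpleGraph ℕ) (L k : ℕ) : Prop :=
  ∃ pos : Fin k → ℕ, StrictMono pos ∧ (∀ i, pos i ≤ L) ∧
    ∀ i j, H.Adj (pos i) (pos j) ↔ (pathGraph k).Adj i j

/-- `IncReach H r m x`: there is an increasing walk of length `m` in `H` from `r` to `x`. -/
inductive IncReach (H : SimpleGraph ℕ) (r : ℕ) : ℕ → ℕ → Prop
  | refl : IncReach H r 0 r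
  | step {m x y : ℕ} : IncReach H r m x → x < y → H.Adj x y → IncReach H r (m + 1) y

theorem incReach_of_consecutive {H : SimpleGraph ℕ} {r L : ℕ}
    (hH : ∀ i < L, H.Adj i (i + 1)) (m : ℕ) (hm : r + m ≤ L) : IncReach H r m (r + m) := by
  induction m with
  | zero => exact .refl
  | succ m ih => exact .step (ih (by omega)) (Nat.lt_succ_self _) (hH _ (by omega))

/-- The depth function and the parent map of a breadth-first tree for increasing walks from `r`. -/
theorem exists_depth_parent {H : SimpleGraph ℕ} {L : ℕ} (hH : ∀ i < L, H.Adj i (i + 1)) (r : ℕ) :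
    ∃ d par : ℕ → ℕ, d r = 0 ∧ par r = r ∧ (∀ x, par x ≤ x) ∧
      (∀ x, r < x → x ≤ L → r ≤ par x ∧ par x < x ∧ H.Adj (par x) x ∧ d x = d (par x) + 1) ∧
      ∀ x y, r ≤ x → x < y → y ≤ L → H.Adj x y → d y ≤ d x + 1 := by
  classical
  set d : ℕ → ℕ := fun x => sInf {m | IncReach H r m x} with hd
  have hle : ∀ {m x}, IncReach H r m x → d x ≤ m := fun h => Nat.sInf_le h
  have hmem : ∀ x, r ≤ x → x ≤ L → IncReach H r (d x) x := fun x h1 h2 =>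
    Nat.sInf_mem (s := {m | IncReach H r m x}) ⟨x - r, by
      have := incReach_of_consecutive (r := r) hH (x - r) (by omega)
      rwa [Nat.add_sub_cancel' h1] at this⟩
  have hge : ∀ {m x}, IncReach H r m x → r ≤ x := fun h => by
    induction h with
    | refl => exact le_rfl
    | step _ h _ ih => omega
  have hedge : ∀ x y, r ≤ x → x < y → y ≤ L → H.Adj x y → d y ≤ d x + 1 :=
    fun x y hx hxy hy hadj => hle (.step (hmem x hx (by omega)) hxy hadj)
  have hpar : ∀ x, r < x ∧ x ≤ L →
      ∃ y, r ≤ y ∧ y < x ∧ H.Adj y x ∧ d x = d y + 1 := by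
    rintro x ⟨hrx, hxL⟩
    have hx := hmem x hrx.le hxL
    generalize hm : d x = m at hx
    cases hx with
    | refl => omega
    | @step m y _ hy hyx hadj =>
      have h1 := hle hy
      have h2 := hedge y x (hge hy) hyx hxL hadj
      exact ⟨y, hge hy, hyx, hadj, by omega⟩
  choose! p hp using hpar
  refine ⟨d, fun x => if r < x ∧ x ≤ L then p x else x, ?_, by simp, fun x => ?_,
    fun x h1 h2 => ?_, hedge⟩
  · exact Nat.le_zero.1 (hle .refl)
  · dsimp only
    split_ifs with h
    · exact (hp x h).2.1.le
    · exact le_rfl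
  · simp only [h1, h2, and_self, if_true]
    exact hp x ⟨h1, h2⟩

/-- Shortest increasing walks are induced: a chord would be a shortcut. So without an increasing
induced path on `k` vertices, every breadth-first tree for increasing walks has depth less
than `k`. -/
theorem exists_shallow_tree {H : SimpleGraph ℕ} {L k : ℕ} (hH : ∀ i < L, H.Adj i (i + 1))
    (hk : ¬ HasIncreasingInducedPath H L k) (r : ℕ) :
    ∃ par : ℕ → ℕ, par r = r ∧ (∀ x, par x ≤ x) ∧
      (∀ x, r < x → x ≤ L → r ≤ par x ∧ H.Adj (par x) x) ∧
      ∀ x, r ≤ x → x ≤ L → par^[k - 1] x = r := by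
  obtain ⟨d, par, hdr, hparr, hle, hpar, hedge⟩ := exists_depth_parent hH r
  refine ⟨par, hparr, hle, fun x h1 h2 => ⟨(hpar x h1 h2).1, (hpar x h1 h2).2.2.1⟩,
    fun x hrx hxL => ?_⟩
  have hanc : ∀ m ≤ d x, r ≤ par^[m] x ∧ par^[m] x ≤ L ∧ d (par^[m] x) + m = d x := by
    intro m
    induction m with
    | zero => intro _; exact ⟨hrx, hxL, rfl⟩
    | succ m ih =>
      intro hm
      obtain ⟨h1, h2, h3⟩ := ih (by omega)
      have hne : r ≠ par^[m] x := fun h => by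
        rw [← h, hdr] at h3
        omega
      obtain ⟨h4, h5, -, h6⟩ := hpar _ (lt_of_le_of_ne h1 hne) h2
      rw [Function.iterate_succ_apply']
      exact ⟨h4, by omega, by omega⟩
  have hroot : ∀ y, r ≤ y → y ≤ L → d y = 0 → y = r := by
    intro y h1 h2 h3
    by_contra hne
    have := (hpar y (by omega) h2).2.2.2
    omega
  have hdx : d x < k := by
    by_contra! hdk
    refine hk ⟨fun i => par^[d x - i] x, ?_, fun i => (hanc _ (by omega)).2.1, ?_⟩
    all_goals
      have hstep : ∀ i, i < d x → par^[d x - i] x = par (par^[d x - (i + 1)] x) ∧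
          par (par^[d x - (i + 1)] x) < par^[d x - (i + 1)] x ∧
          H.Adj (par^[d x - i] x) (par^[d x - (i + 1)] x) := by
        intro i hi
        rw [show d x - i = (d x - (i + 1)) + 1 by omega, Function.iterate_succ_apply']
        obtain ⟨h1, h2, h3⟩ := hanc (d x - (i + 1)) (by omega)
        have hne : r ≠ par^[d x - (i + 1)] x := fun h => by
          rw [← h, hdr] at h3
          omega
        obtain ⟨-, h5, h6, -⟩ := hpar _ (lt_of_le_of_ne h1 hne) h2
        exact ⟨rfl, h5, h6⟩
      have hmono : ∀ i j, i < j → j ≤ d x → par^[d x - i] x < par^[d x - j] x := by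
        intro i j hij
        induction j, hij using Nat.le_induction with
        | base =>
          intro hj
          have := hstep i (by omega)
          simp only [Nat.succ_eq_add_one]
          omega
        | succ j hij ih =>
          intro hj
          have := hstep j (by omega)
          have := ih (by omega)
          omega
    · intro i j hij
      exact hmono i j hij (by omega)
    · have key : ∀ i j : ℕ, i < j → j < k →
          (H.Adj (par^[d x - i] x) (par^[d x - j] x) ↔ i + 1 = j) := by
        intro i j hij hj
        constructor
        · intro hadj
          obtain ⟨h1, h2, h3⟩ := hanc (d x - i) (by omega)
          obtain ⟨h4, h5, h6⟩ := hanc (d x - j) (by omega)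
          have := hedge _ _ h1 (hmono i j hij (by omega)) h5 hadj
          omega
        · rintro rfl
          exact (hstep i (by omega)).2.2
      intro i j
      rw [pathGraph_adj]
      rcases lt_trichotomy (i : ℕ) j with h | h | h
      · rw [key i j h j.2]
        omega
      · simp only [h, SimpleGraph.irrefl, false_iff]
        omega
      · rw [H.adj_comm, key j i h i.2]
        omega
  have h := hanc (d x) le_rfl
  rw [show k - 1 = (k - 1 - d x) + d x by omega, Function.iterate_add_apply,
    hroot _ h.1 h.2.1 (by omega),
    Function.iterate_fixed hparr]

/-! ### Subdivided stars -/

/-- In a rooted tree given by its parent map (which fixes the root), among more than `M ^ j` nodes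
of depth at most `j` there are `M` that descend through different children from a common ancestor;
moreover the distance `i + 1` to this ancestor may be taken to be the same for all of them. -/
theorem exists_branching {α : Type*} [DecidableEq α] (par : α → α) (M j : ℕ) (r : α)
    (X : Finset α) (hX : ∀ x ∈ X, par^[j] x = r) (hc : M ^ j < X.card) :
    ∃ u i, ∃ Y ⊆ X, i < j ∧ M ≤ Y.card ∧ (∀ x ∈ Y, par^[i + 1] x = u ∧ par^[i] x ≠ u) ∧
      Set.InjOn (par^[i]) (Y : Set α) := by
  induction j generalizing r X with
  | zero =>
    have : X.card ≤ 1 := Finset.card_le_one.2 fun x hx y hy => (hX x hx).trans (hX y hy).symm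
    simp only [pow_zero] at hc
    omega
  | succ j ih =>
    by_cases hM : M ≤ ((X.image par^[j]).erase r).card
    · obtain ⟨Y, hY, hYi, hYim⟩ := Finset.exists_subset_injOn_image_eq_of_surjOn
        (f := par^[j]) (X : Set α) ((X.image par^[j]).erase r) (fun y hy => by
          simpa using (Finset.mem_erase.1 hy).2)
      have hY : Y ⊆ X := by exact_mod_cast hY
      refine ⟨r, j, Y, hY, j.lt_succ_self, ?_, fun x hx => ⟨?_, ?_⟩, hYi⟩
      · rwa [← Finset.card_image_of_injOn hYi, hYim]
      · exact hX x (hY hx)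
      · have := Finset.mem_image_of_mem par^[j] hx
        rw [hYim] at this
        exact (Finset.mem_erase.1 this).1
    · have hcard : (X.image par^[j]).card ≤ M := by
        have := Finset.pred_card_le_card_erase (s := X.image par^[j]) (a := r)
        omega
      obtain ⟨v, -, hv⟩ := Finset.exists_lt_card_fiber_of_mul_lt_card_of_maps_to
        (s := X) (t := X.image par^[j]) (f := par^[j]) (n := M ^ j)
        (fun x hx => Finset.mem_image_of_mem _ hx) (by
          calc _ ≤ M * M ^ j := Nat.mul_le_mul_right _ hcard
            _ = M ^ (j + 1) := (pow_succ' M j).symm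
            _ < _ := hc)
      obtain ⟨u, i, Y, hY, hi, h⟩ := ih v (X.filter fun x => par^[j] x = v)
        (fun x hx => (Finset.mem_filter.1 hx).2) hv
      exact ⟨u, i, Y, hY.trans (Finset.filter_subset _ _), hi.trans j.lt_succ_self, h⟩

/-- A subdivided star in `H` with centre `u` and set of leaves `Y`, all of whose other vertices lie
to the right of the centre. `leg x` is a set of at most `k` vertices that contains the path from the
centre to the leaf `x`; the legs of different leaves meet at most in the centre. -/
structure IsSpider (H : SimpleGraph ℕ) (k u : ℕ) (Y : Finset ℕ) (leg : ℕ → Finset ℕ) : Prop where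
  exists_walk : ∀ x ∈ Y, ∃ w : H.Walk u x, ∀ z ∈ w.support, z ∈ leg x
  center_lt : ∀ x ∈ Y, u < x
  mem_Icc : ∀ x ∈ Y, ∀ z ∈ leg x, u ≤ z ∧ z ≤ x
  card_le : ∀ x ∈ Y, (leg x).card ≤ k
  eq_center : ∀ x ∈ Y, ∀ y ∈ Y, x ≠ y → ∀ z ∈ leg x, z ∈ leg y → z = u

theorem IsSpider.mono {H : SimpleGraph ℕ} {k u : ℕ} {Y Z : Finset ℕ} {leg : ℕ → Finset ℕ}
    (h : IsSpider H k u Y leg) (hZ : Z ⊆ Y) : IsSpider H k u Z leg where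
  exists_walk x hx := h.exists_walk x (hZ hx)
  center_lt x hx := h.center_lt x (hZ hx)
  mem_Icc x hx := h.mem_Icc x (hZ hx)
  card_le x hx := h.card_le x (hZ hx)
  eq_center x hx y hy := h.eq_center x (hZ hx) y (hZ hy)

theorem exists_spider {H : SimpleGraph ℕ} {L k : ℕ} (hH : ∀ i < L, H.Adj i (i + 1))
    (hk : ¬ HasIncreasingInducedPath H L k) (r M : ℕ) (X : Finset ℕ)
    (hX : ∀ x ∈ X, r ≤ x ∧ x ≤ L) (hM0 : 0 < M) (hc : M ^ (k - 1) < X.card) :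
    ∃ u, r ≤ u ∧ ∃ Y ⊆ X, M ≤ Y.card ∧ ∃ leg, IsSpider H k u Y leg := by
  obtain ⟨par, hparr, hle, hpar, hroot⟩ := exists_shallow_tree hH hk r
  obtain ⟨u, i, Y, hYX, hi, hM, hY, hinj⟩ := exists_branching par M (k - 1) r X
    (fun x hx => hroot x (hX x hx).1 (hX x hx).2) hc
  have hanti : ∀ x m n, m ≤ n → par^[n] x ≤ par^[m] x := fun x m n hmn => by
    rw [← Nat.sub_add_cancel hmn, Function.iterate_add_apply]
    generalize par^[m] x = y
    induction n - m with
    | zero => exact le_rfl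
    | succ l ih => rw [Function.iterate_succ_apply']; exact (hle _).trans ih
  have hlt : ∀ x ∈ Y, ∀ m ≤ i, u < par^[m] x := fun x hx m hm => by
    have h1 := hanti x i (i + 1) (Nat.le_succ i)
    have h2 := hanti x m i hm
    have h3 := hY x hx
    omega
  have hr : ∀ x, r ≤ x → x ≤ L → ∀ m, r ≤ par^[m] x := fun x h1 h2 m => by
    induction m with
    | zero => exact h1
    | succ m ih =>
      rw [Function.iterate_succ_apply']
      rcases ih.eq_or_lt with h | h
      · rw [← h, hparr]
      · exact (hpar _ h ((hanti x 0 m (Nat.zero_le _)).trans h2)).1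
  have hru : r ≤ u := by
    obtain ⟨x, hx⟩ := Finset.card_pos.1 (hM0.trans_le hM)
    rw [← (hY x hx).1]
    exact hr x (hX x (hYX hx)).1 (hX x (hYX hx)).2 _
  refine ⟨u, hru, Y, hYX, hM, fun x => (Finset.range (i + 2)).image fun m => par^[m] x,
    fun x hx => ?_, fun x hx => hlt x hx 0 (Nat.zero_le _), fun x hx z hz => ?_,
    fun x hx => ?_, fun x hx y hy hxy z hzx hzy => ?_⟩
  · have hw : ∀ m ≤ i + 1, ∃ w : H.Walk (par^[m] x) x,
        ∀ z ∈ w.support, ∃ l ≤ i + 1, par^[l] x = z := by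
      intro m
      induction m with
      | zero =>
        exact fun _ => ⟨(.nil : H.Walk x x), fun z hz =>
          ⟨0, Nat.zero_le _, (List.mem_singleton.1 hz).symm⟩⟩
      | succ m ih =>
        intro hm
        obtain ⟨w, hw⟩ := ih (by omega)
        have hadj : H.Adj (par^[m + 1] x) (par^[m] x) := by
          rw [Function.iterate_succ_apply']
          exact (hpar _ (hru.trans_lt (hlt x hx m (by omega)))
            ((hanti x 0 m (Nat.zero_le _)).trans (hX x (hYX hx)).2)).2
        refine ⟨.cons hadj w, fun z hz => ?_⟩
        rw [Walk.support_cons, List.mem_cons] at hz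
        rcases hz with rfl | hz
        · exact ⟨m + 1, hm, rfl⟩
        · exact hw z hz
    obtain ⟨w, hw⟩ := hw (i + 1) le_rfl
    refine ⟨w.copy (hY x hx).1 rfl, fun z hz => ?_⟩
    rw [Walk.support_copy] at hz
    obtain ⟨l, hl, rfl⟩ := hw z hz
    exact Finset.mem_image_of_mem _ (Finset.mem_range.2 (by omega))
  · obtain ⟨m, hm, rfl⟩ := Finset.mem_image.1 hz
    rw [Finset.mem_range] at hm
    refine ⟨?_, hanti x 0 m (Nat.zero_le _)⟩
    rw [← (hY x hx).1]
    exact hanti x m (i + 1) (by omega)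
  · refine Finset.card_image_le.trans ?_
    rw [Finset.card_range]
    omega
  · obtain ⟨m, hm, rfl⟩ := Finset.mem_image.1 hzx
    obtain ⟨n, hn, hnm⟩ := Finset.mem_image.1 hzy
    rw [Finset.mem_range] at hm hn
    -- From a common vertex on, the two legs coincide. If both have taken the same number of steps,
    -- they enter `u` through the same child, against injectivity of `par^[i]` on `Y`. Otherwise one
    -- reaches `u` earlier than the other, which then goes below `u`, against `hlt`.
    have key : ∀ x ∈ Y, ∀ y ∈ Y, x ≠ y → ∀ m n, m ≤ n → n ≤ i + 1 → par^[n] y = par^[m] x →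
        par^[m] x = u := by
      intro x hx y hy hxy m n hmn hn h
      by_contra hne
      have hni : n ≤ i := by
        by_contra hcon
        obtain rfl : n = i + 1 := by omega
        exact hne (h ▸ (hY y hy).1)
      have h1 : par^[i - m] (par^[n] y) = par^[i] x := by
        rw [h, ← Function.iterate_add_apply, Nat.sub_add_cancel (by omega)]
      rw [← Function.iterate_add_apply] at h1
      rcases hmn.eq_or_lt with rfl | hlt'
      · rw [Nat.sub_add_cancel hni] at h1
        exact hxy (hinj hx hy h1.symm)
      · have h2 := hanti y (i + 1) (i - m + n) (by omega)
        rw [h1, (hY y hy).1] at h2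
        exact absurd (hlt x hx i le_rfl) (by omega)
    rcases le_total m n with hmn | hmn
    · exact key x hx y hy hxy m n hmn (by omega) hnm
    · rw [← hnm]
      exact key y hy x hx hxy.symm n m hmn (by omega) hnm.symm

/-- Iterating the construction of a subdivided star, each time to the right of the previous centre
and with leaves among the previous leaves. -/
theorem exists_spiders {H : SimpleGraph ℕ} {L k : ℕ} (hH : ∀ i < L, H.Adj i (i + 1))
    (hk : ¬ HasIncreasingInducedPath H L k) (hk1 : 1 ≤ k) {a : ℕ} (ha : 1 ≤ a) (s r : ℕ)
    (X : Finset ℕ) (hX : ∀ x ∈ X, r ≤ x ∧ x ≤ L) (hc : 2 ^ (a * k ^ s) ≤ X.card) :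
    ∃ Y ⊆ X, 2 ^ a ≤ Y.card ∧ ∃ (u : Fin s → ℕ) (leg : Fin s → ℕ → Finset ℕ),
      (∀ i, r ≤ u i) ∧ u.Injective ∧ ∀ i, IsSpider H k (u i) Y (leg i) := by
  induction s generalizing r X with
  | zero =>
    exact ⟨X, subset_rfl, by simpa using hc, Fin.elim0, Fin.elim0, fun i => i.elim0,
      fun i => i.elim0, fun i => i.elim0⟩
  | succ s ih =>
    have hpos : 1 ≤ a * k ^ s := Nat.mul_pos ha (pow_pos hk1 s)
    obtain ⟨v, hv, Z, hZX, hZ, leg₀, hleg₀⟩ := exists_spider hH hk r (2 ^ (a * k ^ s)) X hX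
        (by positivity) <| by
      refine lt_of_lt_of_le ?_ hc
      rw [← pow_mul]
      refine Nat.pow_lt_pow_right one_lt_two ?_
      rw [pow_succ, ← mul_assoc]
      exact Nat.mul_lt_mul_of_pos_left (by omega) hpos
    obtain ⟨Y, hYZ, hY, u, leg, hu, hinj, hleg⟩ := ih (v + 1) Z
      (fun x hx => ⟨hleg₀.center_lt x hx, (hX x (hZX hx)).2⟩) hZ
    refine ⟨Y, hYZ.trans hZX, hY, Fin.cons v u, Fin.cons leg₀ leg, ?_, ?_, ?_⟩
    · refine Fin.cases hv fun i => ?_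
      have := hu i
      simp only [Fin.cons_succ]
      omega
    · refine Fin.cons_injective_iff.2 ⟨?_, hinj⟩
      rintro ⟨i, hi⟩
      have := hu i
      omega
    · refine Fin.cases ?_ fun i => ?_
      · simpa using hleg₀.mono hYZ
      · simpa using hleg i

/-! ### Linking the centres -/

/-- A vertex other than the centre lies on at most one leg of a subdivided star, so many common
leaves contain a prescribed number of leaves whose legs are disjoint and avoid the centres. -/
theorem exists_disjoint_leaves {H : SimpleGraph ℕ} {k t : ℕ} {u : Fin t → ℕ}
    {leg : Fin t → ℕ → Finset ℕ} {Y : Finset ℕ} (hu : u.Injective)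
    (hleg : ∀ i, IsSpider H k (u i) Y (leg i)) {ι : Type*} [DecidableEq ι] (Q : Finset ι)
    (hc : t * (t + Q.card * (t * k)) < Y.card) :
    ∃ g : ι → ℕ, (∀ p ∈ Q, g p ∈ Y) ∧ (∀ p ∈ Q, ∀ i l, u l ∈ leg i (g p) → l = i) ∧
      ∀ p ∈ Q, ∀ q ∈ Q, p ≠ q → ∀ i j, ∀ z ∈ leg i (g p), z ∈ leg j (g q) → z ∈ Set.range u := by
  induction Q using Finset.induction_on with
  | empty => exact ⟨fun _ => 0, by simp, by simp, by simp⟩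
  | insert p₀ Q hp₀ ih =>
    rw [Finset.card_insert_of_notMem hp₀] at hc
    obtain ⟨g, hgY, hgu, hgd⟩ := ih <| lt_of_le_of_lt (by gcongr; omega) hc
    set B : Finset ℕ := Finset.univ.image u ∪
      Q.biUnion fun p => Finset.univ.biUnion fun i => leg i (g p) with hB
    have hBcard : B.card ≤ t + Q.card * (t * k) := by
      refine (Finset.card_union_le _ _).trans (Nat.add_le_add ?_ ?_)
      · exact Finset.card_image_le.trans (by simp)
      · refine Finset.card_biUnion_le_card_mul _ _ _ fun p hp => ?_
        refine (Finset.card_biUnion_le_card_mul _ _ k fun i _ =>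
          (hleg i).card_le _ (hgY p hp)).trans (by simp)
    set E : Finset ℕ := (Finset.univ ×ˢ B).biUnion fun q : Fin t × ℕ =>
      Y.filter fun x => q.2 ∈ leg q.1 x ∧ q.2 ≠ u q.1 with hE
    have hEcard : E.card ≤ t * B.card := by
      refine (Finset.card_biUnion_le_card_mul _ _ 1 fun q _ => ?_).trans (by simp)
      refine Finset.card_le_one.2 fun x hx y hy => ?_
      rw [Finset.mem_filter] at hx hy
      by_contra hxy
      exact hx.2.2 ((hleg q.1).eq_center x hx.1 y hy.1 hxy q.2 hx.2.1 hy.2.1)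
    obtain ⟨x, hxY, hxE⟩ : ∃ x ∈ Y, x ∉ E := by
      refine Finset.exists_mem_notMem_of_card_lt_card (lt_of_le_of_lt hEcard (lt_of_le_of_lt ?_ hc))
      exact Nat.mul_le_mul_left _ (hBcard.trans (by gcongr; omega))
    have hx : ∀ i, ∀ z ∈ B, z ∈ leg i x → z = u i := by
      intro i z hz hzx
      by_contra hne
      exact hxE (Finset.mem_biUnion.2 ⟨(i, z), by simpa using hz, by simp [hxY, hzx, hne]⟩)
    have hxu : ∀ i l, u l ∈ leg i x → l = i := fun i l h =>
      hu (hx i _ (Finset.mem_union_left _ (Finset.mem_image_of_mem _ (Finset.mem_univ l))) h)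
    have hxd : ∀ q ∈ Q, ∀ i j, ∀ z ∈ leg i x, z ∈ leg j (g q) → z ∈ Set.range u := by
      intro q hq i j z hzi hzj
      refine ⟨i, (hx i z (Finset.mem_union_right _ ?_) hzi).symm⟩
      exact Finset.mem_biUnion.2 ⟨q, hq, Finset.mem_biUnion.2 ⟨j, Finset.mem_univ j, hzj⟩⟩
    have hne : ∀ p ∈ Q, p ≠ p₀ := fun p hp h => hp₀ (h ▸ hp)
    have hg : ∀ p ∈ Q, Function.update g p₀ x p = g p := fun p hp =>
      Function.update_of_ne (hne p hp) _ _
    refine ⟨Function.update g p₀ x, fun p hp => ?_, fun p hp => ?_, fun p hp q hq hpq => ?_⟩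
    · rcases Finset.mem_insert.1 hp with rfl | hp
      · simpa using hxY
      · rw [hg p hp]
        exact hgY p hp
    · rcases Finset.mem_insert.1 hp with rfl | hp
      · simpa using hxu
      · rw [hg p hp]
        exact hgu p hp
    · rcases Finset.mem_insert.1 hp with rfl | hp <;> rcases Finset.mem_insert.1 hq with rfl | hq
      · exact absurd rfl hpq
      · rw [hg q hq, Function.update_self]
        exact hxd q hq
      · rw [hg p ‹p ∈ Q›, Function.update_self]
        exact fun i j z hzi hzj => hxd p ‹p ∈ Q› j i z hzj hzi
      · rw [hg p hp, hg q hq]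
        exact hgd p hp q hq hpq

/-- Disjoint connecting sets suffice for a subdivision of a complete graph: for `i < j` a walk from
`b i` to `b j` is shortened to a path inside `S (i, j)`. -/
theorem isTopologicalMinor_completeGraph_of_sets {V : Type*} {G : SimpleGraph V} {t : ℕ}
    {b : Fin t → V} (hb : b.Injective) (S : Fin t × Fin t → Set V)
    (hwalk : ∀ i j, i < j → ∃ w : G.Walk (b i) (b j), ∀ z ∈ w.support, z ∈ S (i, j))
    (hbranch : ∀ i j, i < j → ∀ l, b l ∈ S (i, j) → l = i ∨ l = j)
    (hS : ∀ p q : Fin t × Fin t, p ≠ q → ∀ z ∈ S p, z ∈ S q → z ∈ Set.range b) :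
    IsTopologicalMinor (completeGraph (Fin t)) G := by
  classical
  choose w hw using hwalk
  have hbyp : ∀ i j (h : i < j), ∀ z ∈ (w i j h).bypass.support, z ∈ S (i, j) := fun i j h z hz =>
    hw i j h z (Walk.support_bypass_subset_support _ hz)
  let W : ∀ {i j : Fin t}, (completeGraph (Fin t)).Adj i j → G.Walk (b i) (b j) := fun {i j} h =>
    if hij : i < j then (w i j hij).bypass
    else (w j i (lt_of_le_of_ne (not_lt.1 hij) (Ne.symm h))).bypass.reverse
  have hW : ∀ {i j : Fin t} (h : (completeGraph (Fin t)).Adj i j) (z : V), z ∈ (W h).support →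
      z ∈ S (min i j, max i j) := by
    intro i j h z hz
    by_cases hij : i < j
    · simp only [W, hij, dite_true] at hz
      rw [min_eq_left hij.le, max_eq_right hij.le]
      exact hbyp _ _ _ z hz
    · simp only [W, hij, dite_false, Walk.support_reverse, List.mem_reverse] at hz
      rw [min_eq_right (not_lt.1 hij), max_eq_left (not_lt.1 hij)]
      exact hbyp _ _ _ z hz
  refine ⟨⟨⟨b, hb⟩, W, fun {i j} h => ?_, fun {i j} h => ?_, fun {i j} h l hl => ?_,
    fun {i j i' j'} h h' x hne hx hx' => ?_⟩⟩
  · by_cases hij : i < j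
    · simp only [W, hij, dite_true]
      exact Walk.bypass_isPath _
    · simp only [W, hij, dite_false]
      exact (Walk.bypass_isPath _).reverse
  · rcases lt_or_gt_of_ne (show i ≠ j from h) with hij | hij
    · simp only [W, hij, not_lt_of_gt hij, dite_true, dite_false]
    · simp only [W, hij, not_lt_of_gt hij, dite_true, dite_false, Walk.reverse_reverse]
  · have hlt : min i j < max i j := min_lt_max.2 h
    have := hbranch _ _ hlt l (hW h _ hl)
    rcases le_total i j with hij | hij <;> simp only [hij, min_eq_left, max_eq_right,
      min_eq_right, max_eq_left] at this <;> tauto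
  · refine hS _ _ (fun heq => hne ?_) x (hW h x hx) (hW h' x hx')
    rw [Prod.mk.injEq] at heq
    rcases le_total i j with hij | hij <;> rcases le_total i' j' with hij' | hij' <;>
      simp only [hij, hij', min_eq_left, max_eq_right, min_eq_right, max_eq_left] at heq <;>
      simp [heq.1, heq.2, Sym2.eq_swap]

theorem isTopologicalMinor_completeGraph_of_not_increasing {V : Type*} {G : SimpleGraph V}
    {a b : V} (P : G.Walk a b) (hP : P.IsPath) {k t e : ℕ} (hk1 : 1 ≤ k) (ht : 0 < t)
    (hk : ¬ HasIncreasingInducedPath (G.comap P.getVert) P.length k)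
    (he : t * (t + t * t * (t * k)) < 2 ^ e) (hn : 2 ^ (e * k ^ t) ≤ P.length + 1) :
    IsTopologicalMinor (completeGraph (Fin t)) G := by
  have he1 : 1 ≤ e := by
    by_contra! he0
    rw [Nat.lt_one_iff.1 he0, pow_zero, Nat.lt_one_iff] at he
    simp [ht.ne'] at he
  have hH : ∀ i < P.length, (G.comap P.getVert).Adj i (i + 1) := fun i hi => P.adj_getVert_succ hi
  have hinj := hP.getVert_injOn
  obtain ⟨Y, hYX, hY, u, leg, -, hu, hleg⟩ := exists_spiders hH hk hk1 he1 t 0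
    (Finset.range (P.length + 1)) (fun x hx => ⟨Nat.zero_le _, by simpa [Nat.lt_succ_iff] using hx⟩)
    (by simpa using hn)
  obtain ⟨g, hgY, hgu, hgd⟩ := exists_disjoint_leaves hu hleg
    (Finset.univ : Finset (Fin t × Fin t)) (by simpa using he.trans_le hY)
  have hYL : ∀ x ∈ Y, x ≤ P.length := fun x hx => by
    simpa [Nat.lt_succ_iff] using hYX hx
  have hgL : ∀ p i, ∀ z ∈ leg i (g p), z ≤ P.length := fun p i z hz =>
    ((hleg i).mem_Icc _ (hgY p (Finset.mem_univ p)) z hz).2.trans (hYL _ (hgY p (Finset.mem_univ p)))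
  have huL : ∀ i, u i ≤ P.length := fun i =>
    ((hleg i).center_lt _ (hgY (i, i) (Finset.mem_univ _))).le.trans
      (hYL _ (hgY (i, i) (Finset.mem_univ _)))
  refine isTopologicalMinor_completeGraph_of_sets (b := fun i => P.getVert (u i))
    (fun i j h => hu (hinj (huL i) (huL j) h))
    (fun p => P.getVert '' {z | z ∈ leg p.1 (g p) ∨ z ∈ leg p.2 (g p)}) ?_ ?_ ?_
  · intro i j hij
    obtain ⟨w₁, hw₁⟩ := (hleg i).exists_walk _ (hgY (i, j) (Finset.mem_univ _))
    obtain ⟨w₂, hw₂⟩ := (hleg j).exists_walk _ (hgY (i, j) (Finset.mem_univ _))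
    refine ⟨(w₁.append w₂.reverse).map (Hom.comap P.getVert G), fun z hz => ?_⟩
    erw [Walk.support_map, List.mem_map] at hz
    obtain ⟨y, hy, rfl⟩ := hz
    rw [Walk.mem_support_append_iff, Walk.support_reverse, List.mem_reverse] at hy
    exact ⟨y, hy.imp (hw₁ y) (hw₂ y), rfl⟩
  · rintro i j hij l ⟨z, hz, hzl⟩
    have hzL : z ≤ P.length := hz.elim (hgL _ _ z) (hgL _ _ z)
    obtain rfl : z = u l := hinj hzL (huL l) hzl
    exact hz.imp (hgu _ (Finset.mem_univ _) _ _) (hgu _ (Finset.mem_univ _) _ _)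
  · rintro p q hpq _ ⟨z, hz, rfl⟩ ⟨y, hy, hyz⟩
    have hzL : z ≤ P.length := hz.elim (hgL _ _ z) (hgL _ _ z)
    have hyL : y ≤ P.length := hy.elim (hgL _ _ y) (hgL _ _ y)
    obtain rfl : y = z := hinj hyL hzL hyz
    have hmem : y ∈ Set.range u := by
      rcases hz with hz | hz <;> rcases hy with hy | hy <;>
        exact hgd p (Finset.mem_univ _) q (Finset.mem_univ _) hpq _ _ y hz hy
    obtain ⟨i, rfl⟩ := hmem
    exact ⟨i, rfl⟩

theorem exists_increasing_embedding {V : Type*} {G : SimpleGraph V} {a b : V} (P : G.Walk a b)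
    (hP : P.IsPath) {k : ℕ} (hk : HasIncreasingInducedPath (G.comap P.getVert) P.length k) :
    ∃ Q : pathGraph k ↪g inducedOn P, IsIncreasingAlong P Q := by
  obtain ⟨pos, hmono, hL, hadj⟩ := hk
  refine ⟨⟨⟨fun i => ⟨P.getVert (pos i), P.getVert_mem_support _⟩, fun i j h => ?_⟩, ?_⟩,
    pos, hmono, fun i => ⟨hL i, rfl⟩⟩
  · exact hmono.injective (hP.getVert_injOn (hL i) (hL j) (congrArg Subtype.val h))
  · intro i j
    exact hadj i j

/-! ### Estimates -/

theorem eventually_lt_two_pow (t : ℕ) :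
    ∀ᶠ k : ℕ in Filter.atTop, t * (t + t * t * (t * k)) < 2 ^ k := by
  have h := (tendsto_pow_const_div_const_pow_of_one_lt 1 (one_lt_two (α := ℝ))).eventually
    (gt_mem_nhds (show (0 : ℝ) < 1 / (t * (t + t * t * t) + 1) by positivity))
  filter_upwards [h, Filter.eventually_ge_atTop 1] with k hk hk1
  rw [div_lt_div_iff₀ (by positivity) (by positivity), pow_one, one_mul] at hk
  have hk' : k * (t * (t + t * t * t) + 1) < 2 ^ k := by exact_mod_cast hk
  refine lt_of_le_of_lt ?_ hk'
  calc t * (t + t * t * (t * k)) ≤ t * (t * k + t * t * (t * k)) := by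
        gcongr
        exact Nat.le_mul_of_pos_right _ hk1
    _ = k * (t * (t + t * t * t)) := by ring
    _ ≤ _ := by gcongr; omega

/-- With `k` the given power of `log n` rounded up, `n` is large enough for `t` rounds of the
construction of subdivided stars, leaving `2 ^ k` common leaves. The exponent is at most `1 / (4 t)`
and `(t + 1) / (4 t) ≤ 1 / 2`, so a factor of the square root of `log n` is left to absorb the
`2 ^ (t + 1)` that comes from rounding. -/
theorem two_pow_le_of_rpow {n t k : ℕ} (ht : 1 < t) (hn : (4 : ℝ) ^ (t + 1) ≤ Real.logb 2 n)
    (hk : k = ⌈Real.logb 2 n ^ ((1 / 4 : ℝ) / (t * Real.logb 2 t ^ 2))⌉₊) :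
    2 ^ (k * k ^ t) ≤ n := by
  set x := Real.logb 2 n with hx
  have ht' : (2 : ℝ) ≤ t := by exact_mod_cast ht
  have hx1 : 1 ≤ x := (one_le_pow₀ (by norm_num)).trans hn
  have hx0 : 0 < x := by linarith
  have hlog : 1 ≤ Real.logb 2 t := by
    rw [Real.le_logb_iff_rpow_le one_lt_two (by linarith)]
    simpa using ht'
  have hexp : (1 / 4 : ℝ) / (t * Real.logb 2 t ^ 2) ≤ 1 / 4 / t := by
    gcongr
    exact le_mul_of_one_le_right (by linarith) (one_le_pow₀ hlog)
  have hk2 : (k : ℝ) ≤ 2 * x ^ ((1 / 4 : ℝ) / t) := by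
    have h1 : x ^ ((1 / 4 : ℝ) / (t * Real.logb 2 t ^ 2)) ≤ x ^ ((1 / 4 : ℝ) / t) :=
      Real.rpow_le_rpow_of_exponent_le hx1 hexp
    have h2 : 1 ≤ x ^ ((1 / 4 : ℝ) / t) := Real.one_le_rpow hx1 (by positivity)
    have h3 := Nat.ceil_lt_add_one (Real.rpow_nonneg hx0.le ((1 / 4 : ℝ) / (t * Real.logb 2 t ^ 2)))
    rw [← hk] at h3
    linarith
  have hkx : (k : ℝ) ^ (t + 1) ≤ x := by
    have hhalf : x ^ (1 / 2 : ℝ) * x ^ (1 / 2 : ℝ) = x := by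
      rw [← Real.rpow_add hx0]
      norm_num
    have h2 : (2 : ℝ) ^ (t + 1) ≤ x ^ (1 / 2 : ℝ) := by
      have h4 : ((2 : ℝ) ^ (t + 1)) ^ 2 ≤ (x ^ (1 / 2 : ℝ)) ^ 2 := by
        rw [sq (x ^ (1 / 2 : ℝ)), hhalf, ← pow_mul, mul_comm, pow_mul]
        norm_num
        exact hn
      exact le_of_sq_le_sq h4 (by positivity)
    calc (k : ℝ) ^ (t + 1) ≤ (2 * x ^ ((1 / 4 : ℝ) / t)) ^ (t + 1) := by gcongr
      _ = 2 ^ (t + 1) * x ^ ((1 / 4 : ℝ) / t * (t + 1 : ℕ)) := by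
        rw [mul_pow, Real.rpow_mul_natCast hx0.le]
      _ ≤ x ^ (1 / 2 : ℝ) * x ^ (1 / 2 : ℝ) := by
        refine mul_le_mul h2 (Real.rpow_le_rpow_of_exponent_le hx1 ?_) (by positivity)
          (by positivity)
        push_cast
        rw [div_mul_eq_mul_div, div_le_iff₀ (by linarith)]
        linarith
      _ = x := hhalf
  have hn0 : (0 : ℝ) < n := by
    rcases Nat.eq_zero_or_pos n with rfl | h
    · simp [hx] at hx0
    · exact_mod_cast h
  rw [← pow_succ']
  have h : (2 : ℝ) ^ ((k ^ (t + 1) : ℕ) : ℝ) ≤ n :=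
    (Real.le_logb_iff_rpow_le one_lt_two hn0).1 (by exact_mod_cast hkx)
  rw [Real.rpow_natCast] at h
  exact_mod_cast h

theorem mainTheorem4 :
    ∃ c : ℝ, 0 < c ∧ ∀ t : ℕ, 1 < t → ∃ n₀ : ℕ, ∀ n : ℕ, n₀ ≤ n →
      ∀ {V : Type*} (G : SimpleGraph V) {a b : V} (P : G.Walk a b),
        P.IsPath → P.support.length = n →
        ¬ IsTopologicalMinor (SimpleGraph.completeGraph (Fin t)) G →
        ∃ k : ℕ, (Real.logb 2 n) ^ (c / (t * (Real.logb 2 t) ^ 2)) ≤ (k : ℝ) ∧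
          ∃ Q : SimpleGraph.pathGraph k ↪g inducedOn P, IsIncreasingAlong P Q := by
  refine ⟨1 / 4, by norm_num, fun t ht => ?_⟩
  have hpos : (0 : ℝ) < (1 / 4) / (t * Real.logb 2 t ^ 2) := by
    have h1 : (1 : ℝ) < t := by exact_mod_cast ht
    have h2 : 0 < Real.logb 2 t := Real.logb_pos one_lt_two h1
    positivity
  have hlog : Filter.Tendsto (fun n : ℕ => Real.logb 2 n) Filter.atTop Filter.atTop :=
    (Real.tendsto_logb_atTop one_lt_two).comp tendsto_natCast_atTop_atTop
  have hceil : Filter.Tendsto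
      (fun n : ℕ => ⌈Real.logb 2 n ^ ((1 / 4 : ℝ) / (t * Real.logb 2 t ^ 2))⌉₊)
      Filter.atTop Filter.atTop :=
    tendsto_nat_ceil_atTop.comp ((tendsto_rpow_atTop hpos).comp hlog)
  obtain ⟨n₀, hn₀⟩ := Filter.eventually_atTop.1
    ((hlog.eventually_ge_atTop ((4 : ℝ) ^ (t + 1))).and
      ((hceil.eventually (eventually_lt_two_pow t)).and (hceil.eventually_ge_atTop 1)))
  refine ⟨n₀, fun n hn V G a b P hP hlen hminor => ?_⟩
  obtain ⟨hbig, hpow, hk1⟩ := hn₀ n hn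
  refine ⟨_, Nat.le_ceil _, ?_⟩
  by_contra hno
  refine hminor (isTopologicalMinor_completeGraph_of_not_increasing P hP hk1 (by omega)
    (fun h => hno (exists_increasing_embedding P hP h)) hpow ?_)
  rw [← P.length_support, hlen]
  exact two_pow_le_of_rpow ht hbig rfl
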